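/- **Setting.** Let $L=\bigsqcup_{n\ge 0}L_n$ be a graded set, where every $L_n$ is finite and $L_0$ is a singleton; write $|\lambda|=n$ for $\lambda\in L_n$. Let $p^\downarrow:L\times L\to[0,\infty)$ be a down transition function: $p^\downarrow(\lambda,\mu)=0$ unless $|\lambda|=|\mu|+1$, and $\sum_{\mu\in L_{n-1}}p^\downarrow(\lambda,\mu)=1$ for all $n\ge 1$, $\lambda\in L_n$. Let $M=(M_n)_{n\ge0}$ be a coherent system, that is, $M_n$ is a probability measure on $L_n$ and $\sum_{\lambda\in L_n}M_n(\lambda)p^\downarrow(\lambda,\mu)=M_{n-1}(\mu)$ for all $n\ge1$, $\mu\in L_{n-1}$; assume that $M_n(\lambda)>0$ for all $n$ and $\lambda\in L_n$. Put $$p^\uparrow(\lambda,\nu)=\frac{M_{n+1}(\nu)}{M_n(\lambda)}\,p^\downarrow(\nu,\lambda),\qquad T_n(\lambda,\tilde\lambda)=\sum_{\nu\in L_{n+1}}p^\uparrow(\lambda,\nu)\,p^\downarrow(\nu,\tilde\lambda)\qquad(\lambda,\tilde\lambda\in L_n,\ \nu\in L_{n+1}),$$ and let $T_n$ also denote the operator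 $(T_ng)(\lambda)=\sum_{\tilde\lambda\in L_n}T_n(\lambda,\tilde\lambda)g(\tilde\lambda)$ on the space $C(L_n)$ of real functions on $L_n$ with the norm $\|g\|_n=\sup_{L_n}|g|$. Let $\iota_n:L_n\hookrightarrow\bar L$ be injective maps into a topological space $\bar L$, and assume: * (A1) $\bar L$ is compact and metrizable (hence separable). $C(\bar L)$ is the Banach space of real continuous functions on $\bar L$ with the supremum norm, and $\pi_n:C(\bar L)\to C(L_n)$ is defined by $(\pi_nf)(\lambda)=f(\iota_n(\lambda))$. * (A2) Every nonempty open subset of $\bar L$ meets $\iota_n(L_n)$ for all sufficiently large $n$. * (A3) $\mathcal F$ is a dense linear subspace of $C(\bar L)$ with an ascending filtration $\mathcal F^0\subseteq\mathcal F^1\subseteq\cdots$ by finite-dimensional subspaces, $\bigcup_m\mathcal F^m=\mathcal F$, such that for every $m$ the space $\pi_n(\mathcal F^m)$ is invariant under $T_n$ for all sufficiently large $n$. (By (A2), $\pi_n$ is injective on $\mathcal F^m$ for large $n$, so that $\mathcal F^m$ is identified with $\pi_n(\mathcal F^m)$ and $T_n$ acts in $\mathcal F^m$ for large $n$.) * (A4)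 $(\varepsilon_n)$ is a sequence of positive numbers converging to $0$ such that, under the identification $\mathcal F^m=\pi_n(\mathcal F^m)$, the limit $Af=\lim_{n\to\infty}\varepsilon_n^{-1}(T_n-1)f$ exists in the finite-dimensional space $\mathcal F^m$ for every $m$ and every $f\in\mathcal F^m$. * (A5) $\mathcal F$ contains the constant function $1$. **Proposition 1.4.** The limits in (A4) define a unique linear operator $A:\mathcal F\to\mathcal F$, which preserves every $\mathcal F^m$. Moreover: 1. $A$, regarded as an operator in $C(\bar L)$ with domain $\mathcal F$, is closable. 2. The closure $\bar A$ is the generator of a conservative Markov semigroup $\{T(t)\}_{t\ge0}$ in $C(\bar L)$, that is, of a strongly continuous semigroup of contractions preserving the cone of nonnegative functions and the constant function $1$. 3. For every $f\in C(\bar L)$ and every $S\ge 0$, $$\lim_{n\to\infty}\ \sup_{0\le t\le S}\big\|T_n^{[\varepsilon_n^{-1}t]}\pi_n(f)-\pi_n(T(t)f)\big\|_n=0,$$ where $[x]$ denotes the integer part of $x$. -/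

import Mathlib

open Filter Topology
open scoped NNReal

namespace UpDown

/-- A "down" transition function on a graded set `L = ⨆ₙ Lₙ` with finite levels. Since
`p↓(lam, mu)` vanishes unless `|lam| = |mu| + 1`, it is given by its restrictions to
`Lₙ₊₁ × Lₙ`, each of which is a stochastic matrix. -/
structure DownKernel (L : ℕ → Type*) [∀ n, Fintype (L n)] where
  /-- `prob n lam mu` is `p↓(lam, mu)` for `lam ∈ Lₙ₊₁` and `mu ∈ Lₙ`. -/
  prob : ∀ n, L (n + 1) → L n → ℝ
  nonneg : ∀ n lam mu, 0 ≤ prob n lam mu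
  sum_eq_one : ∀ n lam, ∑ mu, prob n lam mu = 1

/-- A coherent system: probability measures `Mₙ` on the finite sets `Lₙ` (given by the masses of
the singletons) such that the down kernel sends `Mₙ₊₁` to `Mₙ`. -/
structure CoherentSystem {L : ℕ → Type*} [∀ n, Fintype (L n)] (p : DownKernel L) where
  mass : ∀ n, L n → ℝ
  nonneg : ∀ n lam, 0 ≤ mass n lam
  sum_eq_one : ∀ n, ∑ lam, mass n lam = 1
  coherent : ∀ n mu, ∑ lam, mass (n + 1) lam * p.prob n lam mu = mass n mu

namespace CoherentSystem

variable {L : ℕ → Type*} [∀ n, Fintype (L n)] {p : DownKernel L}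

/-- The support of `Mₙ` is the whole of `Lₙ`, for every `n`. -/
def FullSupport (M : CoherentSystem p) : Prop := ∀ n lam, 0 < M.mass n lam

/-- The "up" transition function `p↑(lam, nu) = Mₙ₊₁(nu) / Mₙ(lam) * p↓(nu, lam)`, for `lam ∈ Lₙ`
and `nu ∈ Lₙ₊₁`. -/
noncomputable def up (M : CoherentSystem p) (n : ℕ) (lam : L n) (nu : L (n + 1)) : ℝ :=
  M.mass (n + 1) nu / M.mass n lam * p.prob n nu lam

/-- The transition matrix of the `n`-th level up-down chain. -/
noncomputable def upDownMatrix (M : CoherentSystem p) (n : ℕ) : Matrix (L n) (L n) ℝ :=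
  Matrix.of fun lam lam' => ∑ nu, M.up n lam nu * p.prob n nu lam'

/-- The Markov operator `Tₙ` of the up-down chain, acting on functions on `Lₙ` by
`(Tₙ g)(lam) = ∑ lam', Tₙ(lam, lam') g(lam')`. The space `L n → ℝ` carries the supremum norm. -/
noncomputable def upDown (M : CoherentSystem p) (n : ℕ) : Module.End ℝ (L n → ℝ) :=
  (M.upDownMatrix n).mulVecLin

end CoherentSystem

section Ambient

variable {X : Type*} [TopologicalSpace X] {L : ℕ → Type*}

/-- The restriction map `πₙ : C(X) → C(Lₙ)`, `(πₙ f)(lam) = f(ιₙ(lam))`. -/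
def restr (ι : ∀ n, L n ↪ X) (n : ℕ) : C(X, ℝ) →ₗ[ℝ] (L n → ℝ) where
  toFun f lam := f (ι n lam)
  map_add' _ _ := rfl
  map_smul' _ _ := rfl

/-- The images of the levels approximate `X`: every nonempty open set meets `ιₙ(Lₙ)` for all
large `n`. -/
def Approximates (ι : ∀ n, L n ↪ X) : Prop :=
  ∀ U : Set X, IsOpen U → U.Nonempty → ∀ᶠ n in atTop, (Set.range (ι n) ∩ U).Nonempty

variable [CompactSpace X] [∀ n, Fintype (L n)] {p : DownKernel L}

/-- `F` is a dense subspace of `C(X)`, exhausted by an ascending filtration by finite-dimensional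
subspaces `Fil m`, and for every `m` the space `πₙ(Fil m)` is invariant under `Tₙ` for all
large `n`. -/
structure IsInvariantFiltration (M : CoherentSystem p) (ι : ∀ n, L n ↪ X)
    (F : Submodule ℝ C(X, ℝ)) (Fil : ℕ → Submodule ℝ C(X, ℝ)) : Prop where
  dense : Dense (F : Set C(X, ℝ))
  mono : Monotone Fil
  iSup_eq : ⨆ m, Fil m = F
  finiteDimensional : ∀ m, FiniteDimensional ℝ (Fil m)
  invariant : ∀ m, ∀ᶠ n in atTop,
    ((Fil m).map (restr ι n)).map (M.upDown n) ≤ (Fil m).map (restr ι n)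

/-- `h` is the limit of `εₙ⁻¹ (Tₙ - 1) f` in the finite-dimensional space `V`, under the
identification of `V` with `πₙ(V)`: for large `n` the function `Tₙ (πₙ f)` is identified with
the element `g n` of `V` (unique for large `n`) that restricts to it. -/
def IsLimitIn (M : CoherentSystem p) (ι : ∀ n, L n ↪ X) (ε : ℕ → ℝ)
    (V : Submodule ℝ C(X, ℝ)) (f h : C(X, ℝ)) : Prop :=
  h ∈ V ∧ ∃ g : ℕ → C(X, ℝ), (∀ n, g n ∈ V) ∧
    (∀ᶠ n in atTop, restr ι n (g n) = M.upDown n (restr ι n f)) ∧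
    Tendsto (fun n => (ε n)⁻¹ • (g n - f)) atTop (𝓝 h)

/-- `A` is the limit operator `A = lim εₙ⁻¹ (Tₙ - 1)`, with domain `F`: it preserves every
`Fil m`, and on `Fil m` it is given by the limit in `Fil m`. -/
def IsLimitOperator (M : CoherentSystem p) (ι : ∀ n, L n ↪ X) (ε : ℕ → ℝ)
    (F : Submodule ℝ C(X, ℝ)) (Fil : ℕ → Submodule ℝ C(X, ℝ))
    (A : C(X, ℝ) →ₗ.[ℝ] C(X, ℝ)) : Prop :=
  A.domain = F ∧ ∀ m, ∀ f : A.domain, (f : C(X, ℝ)) ∈ Fil m → IsLimitIn M ι ε (Fil m) f (A f)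

end Ambient

/-- A conservative Markov semigroup in `C(X)`: a strongly continuous semigroup of contractions
preserving the cone of nonnegative functions and the constant function `1`. -/
structure ConservativeMarkovSemigroup (X : Type*) [TopologicalSpace X] [CompactSpace X] where
  op : ℝ≥0 → C(X, ℝ) →L[ℝ] C(X, ℝ)
  op_zero : op 0 = ContinuousLinearMap.id ℝ C(X, ℝ)
  op_add : ∀ s t, op (s + t) = (op s).comp (op t)
  continuous_op : ∀ f, Continuous fun t => op t f
  norm_op_le : ∀ t, ‖op t‖ ≤ 1
  op_nonneg : ∀ t f, 0 ≤ f → 0 ≤ op t f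
  op_one : ∀ t, op t 1 = 1

/-- `B` is the (infinitesimal) generator of the semigroup `T`: `f` is in the domain of `B` and
`B f = g` if and only if `t⁻¹ (T(t) f - f) → g` in norm as `t ↓ 0`. -/
def IsGenerator {X : Type*} [TopologicalSpace X] [CompactSpace X]
    (T : ConservativeMarkovSemigroup X) (B : C(X, ℝ) →ₗ.[ℝ] C(X, ℝ)) : Prop :=
  ∀ f g : C(X, ℝ), (f, g) ∈ B.graph ↔
    Tendsto (fun t : ℝ≥0 => (t : ℝ)⁻¹ • (T.op t f - f)) (𝓝[>] 0) (𝓝 g)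

end UpDown

/-! ### Flows generated by bounded operators. -/

section FiniteDimensionalExponential

variable {E : Type*} [NormedAddCommGroup E] [NormedSpace ℝ E]

/-! On each finite-dimensional piece `Fil m` the limit operator is a matrix, so it generates the
flow `exp (tA)` with no Hille-Yosida theory. One step of the chain agrees with the flow over time `ε
n` up to `o(ε n)`, uniformly on bounded sets of `Fil m`. Summing over at most `S / ε n` steps, with
`Tₙ` a contraction, gives convergence on `[0, S]` (`eventually_norm_pow_floor_sub_expFlow_lt`).
Since the levels approximate `X`, the norm of a function is recovered from its restrictions, so the
flow inherits contractivity from the chains (`norm_expFlow_apply_le_of_approximation`). By density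
the flows extend to a contraction semigroup on `C(X)`, and the convergence extends with them.

The generator is identified in `mem_closure_graph_iff_tendsto`. An integrated estimate along the
flow passes to the closure of the graph, which therefore lies in the graph of the generator; the
latter is single-valued, whence closability. Conversely, dissipativity makes `1 - A` injective on
each `Fil m`, hence surjective there by finite dimension. So `1 - A` has dense range, and the
closure exhausts the generator.

Finally `Tₙ 1 = 1` gives `A 1 = 0` and `T(t) 1 = 1`, and a contraction of `C(X)` fixing `1` is
positive. -/

theorem NormedSpace.exp_smul_add {R : Type*} [NormedRing R] [NormedAlgebra ℝ R] [CompleteSpace R]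
    (a : R) (s t : ℝ) : exp ((s + t) • a) = exp (s • a) * exp (t • a) := by
  let _ : NormedAlgebra ℚ R := NormedAlgebra.restrictScalars ℚ ℝ R
  rw [add_smul]
  exact exp_add_of_commute (((Commute.refl a).smul_left s).smul_right t)

theorem NormedSpace.continuous_exp_smul {R : Type*} [NormedRing R] [NormedAlgebra ℝ R]
    [CompleteSpace R] (a : R) : Continuous fun t : ℝ => exp (t • a) :=
  continuous_iff_continuousAt.2 fun t => (hasDerivAt_exp_smul_const a t).continuousAt

/-- Exponentials of intertwined operators are intertwined. -/
theorem NormedSpace.exp_apply_of_intertwine {V W : Type*} [NormedAddCommGroup V] [NormedSpace ℝ V]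
    [CompleteSpace V] [NormedAddCommGroup W] [NormedSpace ℝ W] [CompleteSpace W]
    (i : V →L[ℝ] W) (a : V →L[ℝ] V) (b : W →L[ℝ] W) (h : ∀ v, b (i v) = i (a v)) (v : V) :
    exp b (i v) = i (exp a v) := by
  have hpow : ∀ k : ℕ, (b ^ k) (i v) = i ((a ^ k) v) := by
    intro k
    induction k with
    | zero => simp
    | succ k ih => rw [pow_succ', pow_succ', mul_apply_eq_comp, ih, h]; rfl
  have h₁ := (exp_series_hasSum_exp' (𝕂 := ℝ) b).mapL (ContinuousLinearMap.apply ℝ W (i v))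
  have h₂ := (exp_series_hasSum_exp' (𝕂 := ℝ) a).mapL (i.comp (ContinuousLinearMap.apply ℝ V v))
  refine h₁.unique (h₂.congr_fun ?_)
  intro k
  simp [hpow]

/-- The one-parameter group `exp (t a)` generated by a bounded operator `a`. -/
noncomputable def ContinuousLinearMap.expFlow (a : E →L[ℝ] E) (t : ℝ) : E →L[ℝ] E :=
  NormedSpace.exp (t • a)

namespace ContinuousLinearMap

variable (a : E →L[ℝ] E)

@[simp]
theorem expFlow_zero : a.expFlow 0 = 1 := by
  simp [expFlow]

variable [CompleteSpace E]

theorem expFlow_add (s t : ℝ) (v : E) : a.expFlow (s + t) v = a.expFlow s (a.expFlow t v) := by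
  exact DFunLike.congr_fun (NormedSpace.exp_smul_add a s t) v

theorem hasDerivAt_expFlow (t : ℝ) : HasDerivAt a.expFlow (a.expFlow t * a) t :=
  hasDerivAt_exp_smul_const a t

theorem continuous_expFlow_apply (v : E) : Continuous fun t => a.expFlow t v :=
  (NormedSpace.continuous_exp_smul a).clm_apply continuous_const

theorem expFlow_intertwine {W : Type*} [NormedAddCommGroup W] [NormedSpace ℝ W] [CompleteSpace W]
    (i : E →L[ℝ] W) (b : W →L[ℝ] W) (h : ∀ v, b (i v) = i (a v)) (t : ℝ) (v : E) :
    b.expFlow t (i v) = i (a.expFlow t v) :=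
  NormedSpace.exp_apply_of_intertwine i _ _ (fun w => by simp [h]) v

end ContinuousLinearMap

end FiniteDimensionalExponential

/-! ### Gluing linear maps along a filtration. -/

section Gluing

/-- Compatible linear maps on an ascending filtration glue to a linear map on its union. -/
theorem Submodule.exists_linearMap_iSup {R M N : Type*} [Ring R] [AddCommGroup M] [Module R M]
    [AddCommGroup N] [Module R N] {V : ℕ → Submodule R M} (hV : Monotone V) {F : Submodule R M}
    (hF : ⨆ m, V m = F) (φ : ∀ m, V m →ₗ[R] N)
    (hφ : ∀ m m' (h : m ≤ m') (v : V m), φ m' (Submodule.inclusion (hV h) v) = φ m v) :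
    ∃ S : F →ₗ[R] N, ∀ m (v : V m) (hv : (v : M) ∈ F), S ⟨v, hv⟩ = φ m v := by
  have hmem : ∀ f : F, ∃ m, (f : M) ∈ V m := fun f =>
    (Submodule.mem_iSup_of_directed V hV.directed_le).1 (hF ▸ f.2)
  choose d hd using hmem
  -- The value does not depend on the chosen index: two indices are compared inside the piece
  -- indexed by their maximum.
  have key : ∀ (f : F) m (hm : (f : M) ∈ V m), φ (d f) ⟨f, hd f⟩ = φ m ⟨f, hm⟩ := fun f m hm =>
    (hφ _ _ (le_max_left (d f) m) ⟨f, hd f⟩).symm.trans (hφ _ _ (le_max_right (d f) m) ⟨f, hm⟩)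
  refine ⟨{ toFun := fun f => φ (d f) ⟨f, hd f⟩, map_add' := ?_, map_smul' := ?_ }, ?_⟩
  · intro f g
    have hf : (f : M) ∈ V (max (d f) (d g)) := hV (le_max_left _ _) (hd f)
    have hg : (g : M) ∈ V (max (d f) (d g)) := hV (le_max_right _ _) (hd g)
    rw [key f _ hf, key g _ hg, key (f + g) _ (Submodule.add_mem _ hf hg), ← map_add]
    rfl
  · intro c f
    rw [key (c • f) _ (Submodule.smul_mem _ c (hd f)), RingHom.id_apply, ← map_smul]
    rfl
  · intro m v hv
    exact key ⟨v, hv⟩ m v.2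

end Gluing

/-! ### Extension of the flows to a contraction semigroup. -/

section Generation

variable {E : Type*} [NormedAddCommGroup E] [NormedSpace ℝ E] [CompleteSpace E]

/-- Contractive exponentials on the pieces of a dense union of finite-dimensional subspaces extend
to a strongly continuous contraction semigroup. -/
theorem exists_contractionSemigroup {V : ℕ → Submodule ℝ E} (hV : Monotone V)
    [∀ m, FiniteDimensional ℝ (V m)] (hdense : Dense ((⨆ m, V m : Submodule ℝ E) : Set E))
    (a : ∀ m, V m →L[ℝ] V m)
    (ha : ∀ m m' (h : m ≤ m') (v : V m),
      a m' (Submodule.inclusion (hV h) v) = Submodule.inclusion (hV h) (a m v))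
    (hcontr : ∀ m (t : ℝ≥0) (v : V m), ‖(a m).expFlow t v‖ ≤ ‖v‖) :
    ∃ T : ℝ≥0 → E →L[ℝ] E, T 0 = ContinuousLinearMap.id ℝ E ∧
      (∀ s t, T (s + t) = (T s).comp (T t)) ∧ (∀ f, Continuous fun t => T t f) ∧
      (∀ t, ‖T t‖ ≤ 1) ∧ ∀ m t (v : V m), T t v = (a m).expFlow t v := by
  have hcompat : ∀ t : ℝ≥0, ∀ m m' (h : m ≤ m') (v : V m),
      (a m').expFlow t (Submodule.inclusion (hV h) v) =
        Submodule.inclusion (hV h) ((a m).expFlow t v) := by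
    intro t m m' h v
    refine (a m).expFlow_intertwine (LinearMap.toContinuousLinearMap (Submodule.inclusion (hV h)))
      _ (fun w => ?_) t v
    exact ha m m' h w
  have hglue := fun t : ℝ≥0 => Submodule.exists_linearMap_iSup hV rfl
    (fun m => (V m).subtype ∘ₗ ((a m).expFlow t : V m →L[ℝ] V m).toLinearMap) (by
      intro m m' h v
      simp [hcompat t m m' h v])
  choose S hS using hglue
  have hmem : ∀ f : (⨆ m, V m : Submodule ℝ E), ∃ m, (f : E) ∈ V m := fun f =>
    (Submodule.mem_iSup_of_directed V hV.directed_le).1 f.2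
  have hSnorm : ∀ t f, ‖S t f‖ ≤ 1 * ‖(⨆ m, V m : Submodule ℝ E).subtype f‖ := by
    intro t f
    obtain ⟨m, hm⟩ := hmem f
    rw [one_mul, show S t f = S t ⟨(⟨f, hm⟩ : V m), f.2⟩ from rfl, hS]
    exact hcontr m t ⟨f, hm⟩
  have hdr : DenseRange (⨆ m, V m : Submodule ℝ E).subtype := by
    simpa [DenseRange] using! hdense
  let T : ℝ≥0 → E →L[ℝ] E := fun t => (S t).extendOfNorm (⨆ m, V m : Submodule ℝ E).subtype
  have hTV : ∀ m t (v : V m), T t v = (a m).expFlow t v := by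
    intro m t v
    have hv : (v : E) ∈ ⨆ m, V m := le_iSup V m v.2
    exact (LinearMap.extendOfNorm_eq hdr ⟨1, hSnorm t⟩ ⟨v, hv⟩).trans (hS t m v hv)
  have hTnorm : ∀ t, ‖T t‖ ≤ 1 := fun t =>
    LinearMap.opNorm_extendOfNorm_le hdr zero_le_one (hSnorm t)
  have hext : ∀ P Q : E →L[ℝ] E, (∀ m (v : V m), P v = Q v) → P = Q := by
    intro P Q h
    refine DFunLike.coe_injective (Continuous.ext_on hdense P.continuous Q.continuous ?_)
    intro f hf
    obtain ⟨m, hm⟩ := hmem ⟨f, hf⟩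
    exact h m ⟨f, hm⟩
  refine ⟨T, ?_, ?_, ?_, hTnorm, hTV⟩
  · refine hext _ _ fun m v => ?_
    rw [hTV]
    simp
  · intro s t
    refine hext _ _ fun m v => ?_
    rw [ContinuousLinearMap.comp_apply, hTV, hTV, hTV, NNReal.coe_add, (a m).expFlow_add]
  · intro f
    -- Since all `T t` are contractions, the orbit of `f` is a uniform limit of orbits of vectors
    -- `g` in the pieces, which are continuous.
    refine continuous_of_uniform_approx_of_continuous fun u hu => ?_
    obtain ⟨δ, hδ, hδu⟩ := Metric.mem_uniformity_dist.1 hu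
    obtain ⟨g, hg, hgF⟩ := hdense.exists_dist_lt f hδ
    obtain ⟨m, hm⟩ := hmem ⟨g, hg⟩
    refine ⟨fun t => T t g, ?_, fun t => hδu ?_⟩
    · have h := fun t => hTV m t ⟨g, hm⟩
      simp only [h]
      exact continuous_subtype_val.comp
        (((a m).continuous_expFlow_apply _).comp NNReal.continuous_coe)
    · rw [dist_eq_norm, ← map_sub]
      refine lt_of_le_of_lt ((T t).le_of_opNorm_le (hTnorm t) _) ?_
      rwa [one_mul, ← dist_eq_norm]

end Generation

/-! ### Identification of the generator. -/

section Generator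

variable {E : Type*} [NormedAddCommGroup E] [NormedSpace ℝ E] {T : ℝ≥0 → E →L[ℝ] E}

/-- Dissipativity of the generator of a contraction semigroup. -/
theorem norm_le_norm_sub_of_tendsto (hT : ∀ t, ‖T t‖ ≤ 1) {u v : E}
    (h : Tendsto (fun t : ℝ≥0 => (t : ℝ)⁻¹ • (T t u - u)) (𝓝[>] 0) (𝓝 v)) :
    ‖u‖ ≤ ‖u - v‖ := by
  have hlim : Tendsto (fun t : ℝ≥0 => ‖u - v‖ + ‖v - (t : ℝ)⁻¹ • (T t u - u)‖) (𝓝[>] 0)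
      (𝓝 (‖u - v‖ + ‖v - v‖)) := (tendsto_const_nhds.sub h).norm.const_add _
  rw [sub_self, norm_zero, add_zero] at hlim
  refine ge_of_tendsto hlim ?_
  filter_upwards [self_mem_nhdsWithin] with t ht
  have ht' : (0 : ℝ) < t := ht
  have hTu : ‖T t u‖ ≤ ‖u‖ := by simpa using (T t).le_of_opNorm_le (hT t) u
  -- Taking norms and using `‖T t u‖ ≤ ‖u‖`, one copy of `‖u‖` cancels and the rest is divisible by
  -- `t`.
  have hid : (1 + (t : ℝ)) • u =
      T t u + ((t : ℝ) • (u - v) + (t : ℝ) • (v - (t : ℝ)⁻¹ • (T t u - u))) := by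
    rw [smul_sub (t : ℝ) v, smul_inv_smul₀ ht'.ne']
    module
  have hn : ‖(1 + (t : ℝ)) • u‖ ≤ _ :=
    hid ▸ (norm_add_le _ _).trans (add_le_add_right (norm_add_le _ _) _)
  rw [norm_smul, norm_smul, norm_smul, Real.norm_of_nonneg ht'.le,
    Real.norm_of_nonneg (by positivity)] at hn
  nlinarith

variable {V : ℕ → Submodule ℝ E} [∀ m, FiniteDimensional ℝ (V m)]
  {a : ∀ m, V m →L[ℝ] V m}

/-- Mean value inequality for `s ↦ exp(s a) v - s g`, whose derivative is `T s (a v) - g`. Allowing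
`g` to differ from `a v` is what lets the estimate pass to the closure of the graph. -/
theorem norm_semigroup_sub_sub_smul_le
    (hTV : ∀ m t (v : V m), T t v = (a m).expFlow t v) (m : ℕ) (v : V m) (g : E) (t : ℝ≥0) {C : ℝ}
    (hC : ∀ s ≤ t, ‖T s (a m v) - g‖ ≤ C) :
    ‖T t v - v - (t : ℝ) • g‖ ≤ t * C := by
  have hd : ∀ s : ℝ, HasDerivAt (fun s : ℝ => (((a m).expFlow s v : V m) : E) - s • g)
      (((a m).expFlow s (a m v) : V m) - g) s := by
    intro s
    have h₁ := ((V m).subtypeL.hasFDerivAt.comp_hasDerivAt s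
      (((a m).hasDerivAt_expFlow s).clm_apply (hasDerivAt_const s v)))
    have h₂ := h₁.sub ((hasDerivAt_id s).smul_const g)
    simpa using! h₂
  have h := norm_image_sub_le_of_norm_deriv_le_segment' (a := 0) (b := (t : ℝ)) (C := C)
    (fun s _ => (hd s).hasDerivWithinAt) (fun s hs =>
      (congrArg (‖· - g‖) (hTV m ⟨s, hs.1⟩ (a m v))).symm.trans_le (hC ⟨s, hs.1⟩ hs.2.le)) t ⟨t.2, le_rfl⟩
  rw [hTV]
  simp only [ContinuousLinearMap.expFlow_zero, zero_smul, sub_zero,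
    one_apply_eq_self] at h
  rw [mul_comm, sub_right_comm]
  exact h

/-- The closure of the union of the operators `a m` is the generator of the semigroup which they
generate. -/
theorem mem_closure_graph_iff_tendsto (hdense : Dense ((⨆ m, V m : Submodule ℝ E) : Set E))
    (hV : Monotone V) (hT0 : T 0 = ContinuousLinearMap.id ℝ E)
    (hTcont : ∀ f, Continuous fun t => T t f) (hT : ∀ t, ‖T t‖ ≤ 1)
    (hTV : ∀ m t (v : V m), T t v = (a m).expFlow t v) {G : Submodule ℝ (E × E)}
    (hG : ∀ x, x ∈ G ↔ ∃ m, ∃ v : V m, x = ((v : E), (a m v : E))) (f g : E) :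
    (f, g) ∈ G.topologicalClosure ↔
      Tendsto (fun t : ℝ≥0 => (t : ℝ)⁻¹ • (T t f - f)) (𝓝[>] 0) (𝓝 g) := by
  have hforward : ∀ f g, (f, g) ∈ G.topologicalClosure →
      Tendsto (fun t : ℝ≥0 => (t : ℝ)⁻¹ • (T t f - f)) (𝓝[>] 0) (𝓝 g) := by
    intro f g hfg
    have hest : ∀ (t : ℝ≥0) (C : ℝ), (∀ s ≤ t, ‖T s g - g‖ ≤ C) →
        ‖T t f - f - (t : ℝ) • g‖ ≤ t * C := by
      intro t C hC
      -- The extra term `‖x.2 - g‖` makes the bound valid on all of `G`; it vanishes at the limit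
      -- point `(f, g)`.
      have hcl : IsClosed {x : E × E |
          ‖T t x.1 - x.1 - (t : ℝ) • g‖ ≤ t * (‖x.2 - g‖ + C)} :=
        isClosed_le (by fun_prop) (by fun_prop)
      have hsub : (G : Set (E × E)) ⊆ {x : E × E |
          ‖T t x.1 - x.1 - (t : ℝ) • g‖ ≤ t * (‖x.2 - g‖ + C)} := by
        intro x hx
        obtain ⟨m, v, rfl⟩ := (hG x).1 hx
        refine norm_semigroup_sub_sub_smul_le hTV m v g t fun s hs => ?_
        calc ‖T s (a m v) - g‖ = ‖T s (a m v - g) + (T s g - g)‖ := by rw [map_sub]; abel_nf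
          _ ≤ ‖(a m v : E) - g‖ + C := (norm_add_le _ _).trans
            (add_le_add (((T s).le_of_opNorm_le (hT s) _).trans_eq (one_mul _)) (hC s hs))
      simpa using closure_minimal hsub hcl hfg
    rw [Metric.tendsto_nhds]
    intro δ hδ
    have hcont : ∀ᶠ s in 𝓝 (0 : ℝ≥0), ‖T s g - g‖ < δ / 2 := by
      have h := (hTcont g).tendsto 0
      simp only [hT0, ContinuousLinearMap.id_apply] at h
      simpa [dist_eq_norm] using Metric.tendsto_nhds.1 h (δ / 2) (by positivity)
    obtain ⟨r, hr, hrδ⟩ := Metric.eventually_nhds_iff.1 hcont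
    have hball : ∀ᶠ t : ℝ≥0 in 𝓝[>] 0, dist t 0 < r :=
      nhdsWithin_le_nhds (Metric.ball_mem_nhds _ hr)
    filter_upwards [hball, self_mem_nhdsWithin] with t htr ht
    have ht' : (0 : ℝ) < t := ht
    have h := hest t (δ / 2) fun s hs => (hrδ (lt_of_le_of_lt (by
      simpa [NNReal.dist_eq] using hs) htr)).le
    have hid : (t : ℝ)⁻¹ • (T t f - f) - g = (t : ℝ)⁻¹ • (T t f - f - (t : ℝ) • g) := by
      rw [smul_sub _ _ ((t : ℝ) • g), inv_smul_smul₀ ht'.ne']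
    rw [dist_eq_norm, hid, norm_smul, norm_inv, Real.norm_of_nonneg ht'.le,
      inv_mul_lt_iff₀ ht']
    nlinarith
  refine ⟨hforward f g, fun h => ?_⟩
  -- Dissipativity applied to `v - f`, whose difference quotients tend to `a v - g`; here `(v - f) -
  -- (a v - g) = h' - (f - g)`.
  have hdiss : ∀ m (v : V m) (h' : E), (v : E) - a m v = h' → ‖(v : E) - f‖ ≤ ‖h' - (f - g)‖ := by
    intro m v h' hv
    have h₁ := hforward v (a m v) (G.le_topologicalClosure ((hG _).2 ⟨m, v, rfl⟩))
    have h₂ := h₁.sub h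
    have h₃ := norm_le_norm_sub_of_tendsto (u := (v : E) - f) (v := a m v - g) hT
      (h₂.congr fun t => by rw [← smul_sub, map_sub]; abel_nf)
    refine h₃.trans_eq ?_
    rw [← hv]
    abel_nf
  -- Dissipativity gives `‖v‖ ≤ ‖v - a v‖`, so `1 - a m` is injective, hence onto in finite
  -- dimension.
  have hsurj : ∀ m (w : V m), ∃ v : V m, v - a m v = w := by
    intro m
    refine (LinearMap.injective_iff_surjective (f := LinearMap.id - (a m).toLinearMap)).1
      ((injective_iff_map_eq_zero _).2 fun v hv => ?_)
    have h₁ := hforward v (a m v) (G.le_topologicalClosure ((hG _).2 ⟨m, v, rfl⟩))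
    have h₂ := norm_le_norm_sub_of_tendsto hT h₁
    have h₃ : (v : E) - a m v = 0 := congrArg Subtype.val hv
    rw [h₃, norm_zero] at h₂
    exact Subtype.ext (norm_le_zero_iff.1 h₂)
  change (f, g) ∈ closure (G : Set (E × E))
  rw [Metric.mem_closure_iff]
  intro δ hδ
  -- Solving the resolvent equation `v - a v = h'` with `h'` close to `f - g` puts `v` close to `f`,
  -- and then `a v = v - h'` close to `g`.
  obtain ⟨h', hh', hh'd⟩ := hdense.exists_dist_lt (f - g) (half_pos hδ)
  obtain ⟨m, hm⟩ := (Submodule.mem_iSup_of_directed V hV.directed_le).1 hh'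
  obtain ⟨v, hv⟩ := hsurj m ⟨h', hm⟩
  have hv' : (v : E) - a m v = h' := congrArg Subtype.val hv
  have hvf := hdiss m v h' hv'
  rw [dist_comm, dist_eq_norm] at hh'd
  refine ⟨((v : E), (a m v : E)), (hG _).2 ⟨m, v, rfl⟩, ?_⟩
  rw [dist_comm, Prod.dist_eq, max_lt_iff, dist_eq_norm, dist_eq_norm]
  refine ⟨by linarith, ?_⟩
  calc ‖(a m v : E) - g‖ = ‖((v : E) - f) - (h' - (f - g))‖ := by rw [← hv']; abel_nf
    _ ≤ ‖(v : E) - f‖ + ‖h' - (f - g)‖ := norm_sub_le _ _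
    _ < δ := by linarith

end Generator

/-! ### Approximation of flows by powers of contractions in finite dimension. -/

/-- Telescoping estimate for the distance between powers of a contraction and a flow. -/
theorem norm_pow_sub_expFlow_le {V W : Type*} [NormedAddCommGroup V] [NormedSpace ℝ V]
    [CompleteSpace V] [NormedAddCommGroup W] [NormedSpace ℝ W] {a : V →L[ℝ] V} {P : Module.End ℝ W} {r : V →ₗ[ℝ] W} {e C S : ℝ}
    (hP : ∀ y, ‖P y‖ ≤ ‖y‖) (he : 0 ≤ e) (v : V)
    (hstep : ∀ s ∈ Set.Icc 0 S,
      ‖P (r (a.expFlow s v)) - r (a.expFlow e (a.expFlow s v))‖ ≤ C) (k : ℕ) (hk : k * e ≤ S) :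
    ‖(P ^ k) (r v) - r (a.expFlow (k * e) v)‖ ≤ k * C := by
  induction k with
  | zero => simp
  | succ k ih =>
    push_cast at hk ⊢
    have hk' : k * e ≤ S := by nlinarith
    -- The new error is `P` applied to the old error, plus a one-step error at the point reached by
    -- the flow.
    have hid : (P ^ (k + 1)) (r v) - r (a.expFlow ((k + 1) * e) v) =
        P ((P ^ k) (r v) - r (a.expFlow (k * e) v)) +
          (P (r (a.expFlow (k * e) v)) - r (a.expFlow e (a.expFlow (k * e) v))) := by
      rw [← a.expFlow_add, pow_succ', Module.End.mul_apply, map_sub, add_one_mul, add_comm e]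
      abel
    rw [hid, add_one_mul]
    exact (norm_add_le _ _).trans (add_le_add ((hP _).trans (ih hk'))
      (hstep _ ⟨by positivity, hk'⟩))

section FiniteDimensionalApproximation

variable {V : Type*} [NormedAddCommGroup V] [NormedSpace ℝ V] [FiniteDimensional ℝ V]
  {Y : ℕ → Type*} [∀ n, NormedAddCommGroup (Y n)] [∀ n, NormedSpace ℝ (Y n)]

/-- On a finite-dimensional space, pointwise convergence to zero of linear maps with varying
targets is uniform on bounded sets. -/
theorem eventually_norm_le_mul_norm_of_tendsto_zero (D : ∀ n, V →ₗ[ℝ] Y n)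
    (hD : ∀ v, Tendsto (fun n => ‖D n v‖) atTop (𝓝 0)) {η : ℝ} (hη : 0 < η) :
    ∀ᶠ n in atTop, ∀ v, ‖D n v‖ ≤ η * ‖v‖ := by
  let b := Module.finBasis ℝ V
  let c := fun i => LinearMap.toContinuousLinearMap (b.coord i)
  have hlim : Tendsto (fun n => ∑ i, ‖c i‖ * ‖D n (b i)‖) atTop (𝓝 (∑ i, ‖c i‖ * 0)) :=
    tendsto_finsetSum _ fun i _ => (hD (b i)).const_mul _
  simp only [mul_zero, Finset.sum_const_zero] at hlim
  filter_upwards [hlim.eventually_le_const hη] with n hn v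
  calc ‖D n v‖ = ‖∑ i, c i v • D n (b i)‖ := by
        conv_lhs => rw [← b.sum_repr v, map_sum]
        simp [c]
    _ ≤ ∑ i, ‖c i v • D n (b i)‖ := norm_sum_le _ _
    _ ≤ ∑ i, ‖c i‖ * ‖D n (b i)‖ * ‖v‖ := by
        refine Finset.sum_le_sum fun i _ => ?_
        rw [norm_smul, mul_right_comm]
        exact mul_le_mul_of_nonneg_right ((c i).le_opNorm v) (norm_nonneg _)
    _ ≤ η * ‖v‖ := by
        rw [← Finset.sum_mul]
        exact mul_le_mul_of_nonneg_right hn (norm_nonneg _)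

theorem norm_pow_apply_le {W : Type*} [NormedAddCommGroup W] [NormedSpace ℝ W]
    (P : Module.End ℝ W) (hP : ∀ y, ‖P y‖ ≤ ‖y‖) (k : ℕ) (y : W) : ‖(P ^ k) y‖ ≤ ‖y‖ := by
  induction k with
  | zero => simp
  | succ k ih => rw [pow_succ', Module.End.mul_apply]; exact (hP _).trans ih

variable {P : ∀ n, Module.End ℝ (Y n)} {r : ∀ n, V →ₗ[ℝ] Y n} {a : V →L[ℝ] V} {ε : ℕ → ℝ}

/-- One step of the chain is approximated by the flow over time `ε n` up to `o(ε n)`. -/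
theorem eventually_norm_step_sub_expFlow_le (hr : ∀ n v, ‖r n v‖ ≤ ‖v‖) (hε : ∀ n, 0 < ε n)
    (hε0 : Tendsto ε atTop (𝓝 0))
    (hcons : ∀ v, Tendsto (fun n => ‖(ε n)⁻¹ • (P n (r n v) - r n v) - r n (a v)‖) atTop (𝓝 0))
    {η : ℝ} (hη : 0 < η) :
    ∀ᶠ n in atTop, ∀ v, ‖P n (r n v) - r n (a.expFlow (ε n) v)‖ ≤ η * ε n * ‖v‖ := by
  have : CompleteSpace V := FiniteDimensional.complete ℝ V
  have h₁ := eventually_norm_le_mul_norm_of_tendsto_zero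
    -- Half of `η` pays for the consistency error of the chain, the other half for the first-order
    -- Taylor remainder of the flow at time zero.
    (fun n => (ε n)⁻¹ • (P n ∘ₗ r n - r n) - r n ∘ₗ a.toLinearMap) hcons (half_pos hη)
  have h₂ := ((hasDerivAt_iff_isLittleO.1 (a.hasDerivAt_expFlow 0)).def (half_pos hη))
  filter_upwards [h₁, hε0.eventually h₂] with n h₁ h₂ v
  have hn := hε n
  simp only [ContinuousLinearMap.expFlow_zero, one_mul, sub_zero] at h₂
  rw [Real.norm_of_nonneg hn.le] at h₂
  have h₁' : ‖(ε n)⁻¹ • (P n (r n v) - r n v) - r n (a v)‖ ≤ η / 2 * ‖v‖ := h₁ v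
  have h₃ := (a.expFlow (ε n) - 1 - ε n • a).le_of_opNorm_le h₂ v
  have hid : P n (r n v) - r n (a.expFlow (ε n) v) =
      ε n • ((ε n)⁻¹ • (P n (r n v) - r n v) - r n (a v))
        - r n ((a.expFlow (ε n) - 1 - ε n • a) v) := by
    rw [smul_sub, smul_inv_smul₀ hn.ne']
    simp only [sub_apply, one_apply_eq_self,
      smul_apply, map_sub, map_smul]
    abel
  calc _ ≤ ‖ε n • ((ε n)⁻¹ • (P n (r n v) - r n v) - r n (a v))‖
        + ‖r n ((a.expFlow (ε n) - 1 - ε n • a) v)‖ := hid ▸ norm_sub_le _ _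
    _ ≤ ε n * (η / 2 * ‖v‖) + η / 2 * ε n * ‖v‖ := by
        rw [norm_smul, Real.norm_of_nonneg hn.le]
        exact add_le_add (mul_le_mul_of_nonneg_left h₁' hn.le) ((hr n _).trans h₃)
    _ = η * ε n * ‖v‖ := by ring

/-- Trotter-Kurtz convergence of powers of contractions to an exponential on a finite-dimensional
space. -/
theorem eventually_norm_pow_floor_sub_expFlow_lt (hP : ∀ n y, ‖P n y‖ ≤ ‖y‖)
    (hr : ∀ n v, ‖r n v‖ ≤ ‖v‖) (hε : ∀ n, 0 < ε n) (hε0 : Tendsto ε atTop (𝓝 0))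
    (hcons : ∀ v, Tendsto (fun n => ‖(ε n)⁻¹ • (P n (r n v) - r n v) - r n (a v)‖) atTop (𝓝 0))
    (v : V) (S : ℝ) {δ : ℝ} (hδ : 0 < δ) :
    ∀ᶠ n in atTop, ∀ t ∈ Set.Icc 0 S,
      ‖(P n ^ ⌊(ε n)⁻¹ * t⌋₊) (r n v) - r n (a.expFlow t v)‖ < δ := by
  have : CompleteSpace V := FiniteDimensional.complete ℝ V
  rcases lt_or_ge S 0 with hS | hS
  · exact Eventually.of_forall fun n t ht => absurd (ht.1.trans ht.2) hS.not_ge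
  have hcont := (a.continuous_expFlow_apply v).continuousOn (s := Set.Icc 0 S)
  obtain ⟨K, hK⟩ := isCompact_Icc.exists_bound_of_continuousOn hcont
  have hK0 : 0 ≤ K := (norm_nonneg _).trans (hK 0 ⟨le_rfl, hS⟩)
  obtain ⟨ρ, hρ, hunif⟩ := Metric.uniformContinuousOn_iff.1
    (isCompact_Icc.uniformContinuousOn_of_continuous hcont) (δ / 2) (half_pos hδ)
  -- The accumulated error is at most `S * η * K`, which this choice keeps below `δ / 2`; the `+ 1`
  -- covers the case `S * K = 0`.
  have hη : 0 < δ / (2 * (S * K + 1)) := by positivity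
  filter_upwards [eventually_norm_step_sub_expFlow_le hr hε hε0 hcons hη,
    hε0.eventually_lt_const hρ] with n hstep hnρ t ht
  have hn := hε n
  set k := ⌊(ε n)⁻¹ * t⌋₊
  set η := δ / (2 * (S * K + 1))
  have hkt : k * ε n ≤ t := by
    have := Nat.floor_le (show 0 ≤ (ε n)⁻¹ * t from mul_nonneg (inv_nonneg.2 hn.le) ht.1)
    calc k * ε n ≤ (ε n)⁻¹ * t * ε n := mul_le_mul_of_nonneg_right this hn.le
      _ = t := by field_simp
  -- Taking the integer part loses less than one step, so uniform continuity of the orbit absorbs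
  -- the rounding once `ε n < ρ`.
  have htk : t - k * ε n < ε n := by
    have := Nat.lt_floor_add_one ((ε n)⁻¹ * t)
    have h := mul_lt_mul_of_pos_right this hn
    have h' : (ε n)⁻¹ * t * ε n = t := by field_simp
    rw [h'] at h
    change t < (k + 1) * ε n at h
    linarith
  have hkS : k * ε n ≤ S := hkt.trans ht.2
  have h₁ := norm_pow_sub_expFlow_le (C := η * ε n * K) (hP n) hn.le v (fun s hs =>
    (hstep _).trans (mul_le_mul_of_nonneg_left (hK s hs) (by positivity))) k hkS
  have h₂ := hunif (k * ε n) ⟨by positivity, hkS⟩ t ht (by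
    rw [Real.dist_eq, abs_sub_comm, abs_of_nonneg (by linarith)]
    linarith)
  rw [dist_eq_norm] at h₂
  have h₃ : k * (η * ε n * K) < δ / 2 := by
    have hSK : 0 < S * K + 1 := by positivity
    calc k * (η * ε n * K) = (k * ε n) * (η * K) := by ring
      _ ≤ S * (η * K) := mul_le_mul_of_nonneg_right hkS (by positivity)
      _ < η * (S * K + 1) := by nlinarith
      _ = δ / 2 := by simp only [η]; field_simp
  calc _ = ‖((P n ^ k) (r n v) - r n (a.expFlow (k * ε n) v)) +
        r n (a.expFlow (k * ε n) v - a.expFlow t v)‖ := by rw [map_sub, sub_add_sub_cancel]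
    _ ≤ ‖(P n ^ k) (r n v) - r n (a.expFlow (k * ε n) v)‖ +
        ‖r n (a.expFlow (k * ε n) v - a.expFlow t v)‖ := norm_add_le _ _
    _ < δ := by linarith [hr n (a.expFlow (k * ε n) v - a.expFlow t v)]

end FiniteDimensionalApproximation

/-- The map `c ↦ c • v` intertwines the zero operator on `ℝ` with `a`, and the flow of the zero
operator is constant. -/
theorem ContinuousLinearMap.expFlow_apply_of_apply_eq_zero {V : Type*} [NormedAddCommGroup V]
    [NormedSpace ℝ V] [CompleteSpace V] (a : V →L[ℝ] V) {v : V} (h : a v = 0) (t : ℝ) :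
    a.expFlow t v = v := by
  have := (0 : ℝ →L[ℝ] ℝ).expFlow_intertwine (ContinuousLinearMap.toSpanSingleton ℝ v) a
    (by simp [h]) t 1
  simpa [expFlow] using this

/-! ### Passage from the finite-dimensional pieces to the whole space. -/

section Approximation

variable {E : Type*} [NormedAddCommGroup E] [NormedSpace ℝ E] {Y : ℕ → Type*}
  [∀ n, NormedAddCommGroup (Y n)] [∀ n, NormedSpace ℝ (Y n)] {P : ∀ n, Module.End ℝ (Y n)}
  {r : ∀ n, E →ₗ[ℝ] Y n} {ε : ℕ → ℝ}

/-- The flow on a finite-dimensional space is contractive if it is approximated by contractions. -/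
theorem norm_expFlow_apply_le_of_approximation {V : Submodule ℝ E} [FiniteDimensional ℝ V]
    {a : V →L[ℝ] V} (hP : ∀ n y, ‖P n y‖ ≤ ‖y‖) (hr : ∀ n v, ‖r n v‖ ≤ ‖v‖)
    (hnorm : ∀ f c, (∀ᶠ n in atTop, ‖r n f‖ ≤ c) → ‖f‖ ≤ c) (hε : ∀ n, 0 < ε n)
    (hε0 : Tendsto ε atTop (𝓝 0))
    (hcons : ∀ v : V, Tendsto (fun n => ‖(ε n)⁻¹ • (P n (r n v) - r n v) - r n (a v)‖)
      atTop (𝓝 0)) (t : ℝ≥0) (v : V) :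
    ‖a.expFlow t v‖ ≤ ‖v‖ := by
  refine le_of_forall_pos_le_add fun δ hδ => ?_
  have h := eventually_norm_pow_floor_sub_expFlow_lt (a := a) (r := fun n => r n ∘ₗ V.subtype)
    hP (fun n v => hr n (v : E)) hε hε0 hcons v t hδ
  -- It suffices to bound the restrictions of the flow for large `n`; these are `δ`-close to images
  -- of `r n v` under powers of contractions.
  refine hnorm _ _ (h.mono fun n hn => ?_)
  have h₁ := hn t ⟨t.2, le_rfl⟩
  have h₂ := norm_pow_apply_le (P n) (hP n) ⌊(ε n)⁻¹ * (t : ℝ)⌋₊ (r n v)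
  have h₄ := norm_le_norm_add_norm_sub ((P n ^ ⌊(ε n)⁻¹ * (t : ℝ)⌋₊) (r n v))
    (r n (a.expFlow t v : V))
  exact h₄.trans (add_le_add (h₂.trans (hr n v)) h₁.le)

/-- Convergence of contractive chains to a contraction semigroup passes from a dense set to the
whole space. -/
theorem eventually_norm_pow_floor_sub_lt_of_dense (hP : ∀ n y, ‖P n y‖ ≤ ‖y‖)
    (hr : ∀ n v, ‖r n v‖ ≤ ‖v‖) {T : ℝ≥0 → E →L[ℝ] E}
    (hT : ∀ t, ‖T t‖ ≤ 1) {F : Set E} (hF : Dense F) (S : ℝ≥0)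
    (hconv : ∀ f ∈ F, ∀ δ > 0, ∀ᶠ n in atTop, ∀ t ≤ S,
      ‖(P n ^ ⌊(ε n)⁻¹ * (t : ℝ)⌋₊) (r n f) - r n (T t f)‖ < δ)
    (f : E) {δ : ℝ} (hδ : 0 < δ) :
    ∀ᶠ n in atTop, ∀ t ≤ S, ‖(P n ^ ⌊(ε n)⁻¹ * (t : ℝ)⌋₊) (r n f) - r n (T t f)‖ < δ := by
  obtain ⟨g, hgF, hg⟩ := hF.exists_dist_lt f (show 0 < δ / 3 by positivity)
  rw [dist_eq_norm] at hg
  filter_upwards [hconv g hgF (δ / 3) (by positivity)] with n hn t ht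
  set Q := P n ^ ⌊(ε n)⁻¹ * (t : ℝ)⌋₊
  have h₁ : ‖Q (r n (f - g))‖ ≤ ‖f - g‖ := (norm_pow_apply_le _ (hP n) _ _).trans (hr n _)
  have h₂ : ‖r n (T t (f - g))‖ ≤ ‖f - g‖ :=
    (hr n _).trans (((T t).le_of_opNorm_le (hT t) _).trans_eq (one_mul _))
  calc ‖Q (r n f) - r n (T t f)‖
      = ‖Q (r n (f - g)) + (Q (r n g) - r n (T t g)) - r n (T t (f - g))‖ := by
        simp only [map_sub]
        congr 1
        abel
    _ ≤ ‖Q (r n (f - g)) + (Q (r n g) - r n (T t g))‖ + ‖r n (T t (f - g))‖ := norm_sub_le _ _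
    _ ≤ ‖Q (r n (f - g))‖ + ‖Q (r n g) - r n (T t g)‖ + ‖r n (T t (f - g))‖ :=
        add_le_add_left (norm_add_le _ _) _
    _ < δ := by linarith [hn t ht]

/-- A Trotter-Kurtz theorem for operators that preserve the pieces of a filtration by
finite-dimensional subspaces: if contractions `P n` on approximating spaces converge
infinitesimally, then the limit operator generates a contraction semigroup, to which the powers of
the `P n` converge. -/
theorem exists_contractionSemigroup_of_approximation [CompleteSpace E] {V : ℕ → Submodule ℝ E}
    (hV : Monotone V) [∀ m, FiniteDimensional ℝ (V m)]
    (hdense : Dense ((⨆ m, V m : Submodule ℝ E) : Set E)) (a : ∀ m, V m →ₗ[ℝ] V m)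
    (ha : ∀ m m' (h : m ≤ m') (v : V m),
      a m' (Submodule.inclusion (hV h) v) = Submodule.inclusion (hV h) (a m v))
    (hP : ∀ n y, ‖P n y‖ ≤ ‖y‖) (hr : ∀ n v, ‖r n v‖ ≤ ‖v‖)
    (hnorm : ∀ f c, (∀ᶠ n in atTop, ‖r n f‖ ≤ c) → ‖f‖ ≤ c) (hε : ∀ n, 0 < ε n)
    (hε0 : Tendsto ε atTop (𝓝 0))
    (hcons : ∀ m (v : V m), Tendsto (fun n => ‖(ε n)⁻¹ • (P n (r n v) - r n v) - r n (a m v)‖)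
      atTop (𝓝 0)) {G : Submodule ℝ (E × E)}
    (hG : ∀ x, x ∈ G ↔ ∃ m, ∃ v : V m, x = ((v : E), (a m v : E))) :
    ∃ T : ℝ≥0 → E →L[ℝ] E, T 0 = ContinuousLinearMap.id ℝ E ∧
      (∀ s t, T (s + t) = (T s).comp (T t)) ∧ (∀ f, Continuous fun t => T t f) ∧
      (∀ t, ‖T t‖ ≤ 1) ∧ (∀ m (v : V m), a m v = 0 → ∀ t, T t v = v) ∧
      (∀ f g, (f, g) ∈ G.topologicalClosure ↔
        Tendsto (fun t : ℝ≥0 => (t : ℝ)⁻¹ • (T t f - f)) (𝓝[>] 0) (𝓝 g)) ∧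
      ∀ (f : E) (S : ℝ≥0) (δ : ℝ), 0 < δ → ∀ᶠ n in atTop, ∀ t ≤ S,
        ‖(P n ^ ⌊(ε n)⁻¹ * (t : ℝ)⌋₊) (r n f) - r n (T t f)‖ < δ := by
  obtain ⟨b, hb⟩ : ∃ b : ∀ m, V m →L[ℝ] V m, ∀ m v, b m v = a m v :=
    ⟨fun m => LinearMap.toContinuousLinearMap (a m), fun _ _ => rfl⟩
  simp only [← hb] at ha hcons hG ⊢
  have hmem : ∀ f ∈ (⨆ m, V m : Submodule ℝ E), ∃ m, f ∈ V m := fun f =>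
    (Submodule.mem_iSup_of_directed V hV.directed_le).1
  obtain ⟨T, hT0, hTadd, hTcont, hTnorm, hTV⟩ := exists_contractionSemigroup hV hdense b ha
    (fun m t v => norm_expFlow_apply_le_of_approximation hP hr hnorm hε hε0 (hcons m) t v)
  refine ⟨T, hT0, hTadd, hTcont, hTnorm, fun m v hv t => ?_,
    mem_closure_graph_iff_tendsto hdense hV hT0 hTcont hTnorm hTV hG, fun f S δ hδ => ?_⟩
  · exact (hTV m t v).trans (congrArg Subtype.val ((b m).expFlow_apply_of_apply_eq_zero hv t))
  · refine eventually_norm_pow_floor_sub_lt_of_dense hP hr hTnorm hdense S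
      (fun f hf δ hδ => ?_) f hδ
    obtain ⟨m, hm⟩ := hmem f hf
    have h := eventually_norm_pow_floor_sub_expFlow_lt (a := b m)
      (r := fun n => r n ∘ₗ (V m).subtype) hP (fun n v => hr n (v : E)) hε hε0 (hcons m)
      ⟨f, hm⟩ S hδ
    filter_upwards [h] with n hn t ht
    have h₁ : T t f = _ := hTV m t ⟨f, hm⟩
    rw [h₁]
    exact hn t ⟨t.2, ht⟩

end Approximation

/-! ### Positivity of contractions fixing the constants. -/

/-- A contraction of `C(X)` that preserves the constants is positive. -/
theorem ContinuousMap.apply_nonneg_of_norm_le_one {X : Type*} [TopologicalSpace X] [CompactSpace X]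
    (P : C(X, ℝ) →L[ℝ] C(X, ℝ)) (hP : ‖P‖ ≤ 1) (h1 : P 1 = 1) {f : C(X, ℝ)} (hf : 0 ≤ f) :
    0 ≤ P f := by
  intro x
  -- For `f ≥ 0` the function `‖f‖ - f` takes values in `[0, ‖f‖]`. Applying `P` gives `‖f‖ - P f ≤
  -- ‖f‖` pointwise.
  have h₁ : ‖‖f‖ • (1 : C(X, ℝ)) - f‖ ≤ ‖f‖ := by
    refine (ContinuousMap.norm_le _ (norm_nonneg f)).2 fun y => ?_
    have hy : 0 ≤ f y := hf y
    have hy' := (le_abs_self _).trans (f.norm_coe_le_norm y)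
    rw [Real.norm_eq_abs, abs_le]
    simp only [ContinuousMap.sub_apply, ContinuousMap.smul_apply, ContinuousMap.one_apply,
      smul_eq_mul, mul_one]
    constructor <;> linarith
  have h₂ := (P.le_of_opNorm_le hP (‖f‖ • (1 : C(X, ℝ)) - f)).trans ((one_mul _).trans_le h₁)
  rw [map_sub, map_smul, h1] at h₂
  have h₃ := (ContinuousMap.norm_coe_le_norm _ x).trans h₂
  rw [Real.norm_eq_abs, abs_le] at h₃
  simp only [ContinuousMap.sub_apply, ContinuousMap.smul_apply, ContinuousMap.one_apply,
      smul_eq_mul, mul_one] at h₃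
  change 0 ≤ P f x
  linarith

namespace UpDown

/-! ### The up-down chain as a Markov operator. -/

section Chain

variable {L : ℕ → Type*} [∀ n, Fintype (L n)] {p : DownKernel L} (M : CoherentSystem p)

theorem upDown_apply (n : ℕ) (g : L n → ℝ) (lam : L n) :
    M.upDown n g lam = ∑ lam', M.upDownMatrix n lam lam' * g lam' := rfl

theorem upDownMatrix_nonneg (n : ℕ) (lam lam' : L n) : 0 ≤ M.upDownMatrix n lam lam' :=
  Finset.sum_nonneg fun _ _ => mul_nonneg
    (mul_nonneg (div_nonneg (M.nonneg _ _) (M.nonneg _ _)) (p.nonneg _ _ _)) (p.nonneg _ _ _)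

variable {M}

theorem sum_up (hM : M.FullSupport) (n : ℕ) (lam : L n) : ∑ nu, M.up n lam nu = 1 := by
  have h : ∀ nu, M.up n lam nu = (M.mass (n + 1) nu * p.prob n nu lam) / M.mass n lam := fun nu =>
    div_mul_eq_mul_div _ _ _
  simp only [h]
  rw [← Finset.sum_div, M.coherent, div_self (hM n lam).ne']

theorem sum_upDownMatrix (hM : M.FullSupport) (n : ℕ) (lam : L n) :
    ∑ lam', M.upDownMatrix n lam lam' = 1 := by
  change ∑ lam', ∑ nu, M.up n lam nu * p.prob n nu lam' = 1
  rw [Finset.sum_comm]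
  simp only [← Finset.mul_sum, p.sum_eq_one, mul_one]
  exact sum_up hM n lam

theorem norm_upDown_apply_le (hM : M.FullSupport) (n : ℕ) (g : L n → ℝ) :
    ‖M.upDown n g‖ ≤ ‖g‖ := by
  refine (pi_norm_le_iff_of_nonneg (norm_nonneg g)).2 fun lam => ?_
  rw [upDown_apply]
  calc ‖∑ lam', M.upDownMatrix n lam lam' * g lam'‖
      ≤ ∑ lam', ‖M.upDownMatrix n lam lam' * g lam'‖ := norm_sum_le _ _
    _ ≤ ∑ lam', M.upDownMatrix n lam lam' * ‖g‖ := by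
        refine Finset.sum_le_sum fun lam' _ => ?_
        rw [norm_mul, Real.norm_of_nonneg (upDownMatrix_nonneg M n lam lam')]
        exact mul_le_mul_of_nonneg_left (norm_le_pi_norm g lam') (upDownMatrix_nonneg M n _ _)
    _ = ‖g‖ := by rw [← Finset.sum_mul, sum_upDownMatrix hM, one_mul]

theorem upDown_one (hM : M.FullSupport) (n : ℕ) : M.upDown n 1 = 1 := by
  funext lam
  simp [upDown_apply, sum_upDownMatrix hM]

end Chain

/-! ### The limit operator. -/

section Limit

variable {X : Type*} [TopologicalSpace X] {L : ℕ → Type*} [∀ n, Fintype (L n)]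
  {ι : ∀ n, L n ↪ X}
  {p : DownKernel L} {M : CoherentSystem p} {ε : ℕ → ℝ} {V W : Submodule ℝ C(X, ℝ)}
  {f f' h h' : C(X, ℝ)}

theorem IsLimitIn.smul (c : ℝ) (H : IsLimitIn M ι ε V f h) :
    IsLimitIn M ι ε V (c • f) (c • h) := by
  obtain ⟨hh, g, hg, hres, hlim⟩ := H
  refine ⟨V.smul_mem c hh, fun n => c • g n, fun n => V.smul_mem c (hg n), ?_, ?_⟩
  · filter_upwards [hres] with n h₁
    simp only [map_smul, h₁]
  · refine (hlim.const_smul c).congr fun n => ?_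
    rw [← smul_sub, smul_comm]

theorem isLimitIn_one (hM : M.FullSupport) (h1 : 1 ∈ V) : IsLimitIn M ι ε V 1 0 :=
  ⟨V.zero_mem, fun _ => 1, fun _ => h1, Eventually.of_forall fun n => (upDown_one hM n).symm,
    by simp⟩

variable [CompactSpace X]

theorem norm_restr_le (n : ℕ) (f : C(X, ℝ)) : ‖restr ι n f‖ ≤ ‖f‖ :=
  (pi_norm_le_iff_of_nonneg (norm_nonneg f)).2 fun lam => f.norm_coe_le_norm (ι n lam)

/-- If `|f|` exceeded some `d > b` somewhere, it would do so on a nonempty open set, which meets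
every late level. Constant `c` recovers the norm from restrictions; `b = 0` gives uniqueness of
limits. -/
theorem norm_le_of_tendsto_of_norm_restr_le (hι : Approximates ι) {c : ℕ → ℝ} {b : ℝ}
    (hc : Tendsto c atTop (𝓝 b)) (hf : ∀ᶠ n in atTop, ‖restr ι n f‖ ≤ c n) : ‖f‖ ≤ b := by
  have hb : 0 ≤ b := ge_of_tendsto hc (hf.mono fun n hn => (norm_nonneg _).trans hn)
  refine (ContinuousMap.norm_le _ hb).2 fun x => le_of_not_gt fun hx => ?_
  obtain ⟨d, hbd, hdx⟩ := exists_between hx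
  have hU : IsOpen {y | d < ‖f y‖} := isOpen_lt continuous_const f.continuous.norm
  obtain ⟨n, hn, hcn, hfn⟩ := ((hι _ hU ⟨x, hdx⟩).and
    ((hc.eventually_lt_const hbd).and hf)).exists
  obtain ⟨-, ⟨lam, rfl⟩, hlam⟩ := hn
  exact absurd ((hlam.trans_le (norm_le_pi_norm (restr ι n f) lam)).trans_le hfn) hcn.not_gt

theorem IsLimitIn.add (H : IsLimitIn M ι ε V f h) (H' : IsLimitIn M ι ε V f' h') :
    IsLimitIn M ι ε V (f + f') (h + h') := by
  obtain ⟨hh, g, hg, hres, hlim⟩ := H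
  obtain ⟨hh', g', hg', hres', hlim'⟩ := H'
  refine ⟨V.add_mem hh hh', fun n => g n + g' n, fun n => V.add_mem (hg n) (hg' n), ?_, ?_⟩
  · filter_upwards [hres, hres'] with n h₁ h₂
    simp only [map_add, h₁, h₂]
  · refine (hlim.add hlim').congr fun n => ?_
    rw [← smul_add, add_sub_add_comm]

/-- Restriction is a contraction, so convergence in `V` becomes convergence on the levels, in a form
that mentions neither `V` nor the identification. -/
theorem IsLimitIn.tendsto (H : IsLimitIn M ι ε V f h) :
    Tendsto (fun n => ‖(ε n)⁻¹ • (M.upDown n (restr ι n f) - restr ι n f) - restr ι n h‖)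
      atTop (𝓝 0) := by
  obtain ⟨-, g, -, hres, hlim⟩ := H
  refine squeeze_zero' (Eventually.of_forall fun _ => norm_nonneg _) ?_
    (tendsto_iff_norm_sub_tendsto_zero.1 hlim)
  filter_upwards [hres] with n hn
  rw [← hn, ← map_sub, ← map_smul, ← map_sub]
  exact norm_restr_le n _

/-- Both limits are seen on the same levels, so the two subspaces may differ. This yields both
linearity of the limit and its compatibility across the filtration. -/
theorem IsLimitIn.unique (hι : Approximates ι) (H : IsLimitIn M ι ε V f h)
    (H' : IsLimitIn M ι ε W f h') : h = h' := by
  have hlim := H'.tendsto.add H.tendsto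
  rw [add_zero] at hlim
  rw [← sub_eq_zero, ← norm_le_zero_iff]
  refine norm_le_of_tendsto_of_norm_restr_le hι hlim (Eventually.of_forall fun n => ?_)
  refine le_trans (le_of_eq ?_) (norm_sub_le _ _)
  rw [map_sub]
  congr 1
  abel

/-- The limits in the pieces of the filtration define a unique operator. -/
theorem existsUnique_isLimitOperator (hι : Approximates ι) {F : Submodule ℝ C(X, ℝ)}
    {Fil : ℕ → Submodule ℝ C(X, ℝ)} (hmono : Monotone Fil) (hF : ⨆ m, Fil m = F)
    (hlim : ∀ m, ∀ f ∈ Fil m, ∃ h, IsLimitIn M ι ε (Fil m) f h) :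
    ∃! A : C(X, ℝ) →ₗ.[ℝ] C(X, ℝ), IsLimitOperator M ι ε F Fil A := by
  choose! φ hφ using hlim
  obtain ⟨S, hS⟩ := Submodule.exists_linearMap_iSup hmono hF
    (fun m => ({ toFun := fun v => φ m v
                 map_add' := fun v w => (hφ m _ (v + w).2).unique hι ((hφ m v v.2).add (hφ m w w.2))
                 map_smul' := fun c v => (hφ m _ (c • v).2).unique hι ((hφ m v v.2).smul c) } :
      Fil m →ₗ[ℝ] C(X, ℝ)))
    (fun m m' h v => (hφ m' v (hmono h v.2)).unique hι (hφ m v v.2))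
  refine ⟨⟨F, S⟩, ⟨rfl, fun m f hf => ?_⟩, fun B hB => ?_⟩
  · have h : (⟨F, S⟩ : C(X, ℝ) →ₗ.[ℝ] C(X, ℝ)) f = φ m f := hS m ⟨f, hf⟩ f.2
    rw [h]
    exact hφ m f hf
  · refine LinearPMap.ext hB.1 fun x hx hxF => ?_
    have hxF' : x ∈ F := hxF
    obtain ⟨m, hm⟩ := (Submodule.mem_iSup_of_directed Fil hmono.directed_le).1 (hF ▸ hxF')
    exact ((hB.2 m ⟨x, hx⟩ hm).unique hι (hφ m x hm)).trans (hS m ⟨x, hm⟩ hxF').symm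

end Limit

end UpDown

/-! ### The convergence theorem for up-down chains. -/

open UpDown in
theorem proposition1p4 {X : Type*} [TopologicalSpace X] [CompactSpace X]
    [TopologicalSpace.MetrizableSpace X]
    {L : ℕ → Type*} [∀ n, Fintype (L n)] [Unique (L 0)]
    (p : DownKernel L) (M : CoherentSystem p) (hM : M.FullSupport)
    (ι : ∀ n, L n ↪ X) (hι : Approximates ι)
    (F : Submodule ℝ C(X, ℝ)) (Fil : ℕ → Submodule ℝ C(X, ℝ))
    (hF : IsInvariantFiltration M ι F Fil)
    (ε : ℕ → ℝ) (hε : ∀ n, 0 < ε n) (hε0 : Tendsto ε atTop (𝓝 0))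
    (hlim : ∀ m, ∀ f ∈ Fil m, ∃ h, IsLimitIn M ι ε (Fil m) f h)
    (hone : (1 : C(X, ℝ)) ∈ F) :
    (∃! A : C(X, ℝ) →ₗ.[ℝ] C(X, ℝ), IsLimitOperator M ι ε F Fil A) ∧
    ∀ A : C(X, ℝ) →ₗ.[ℝ] C(X, ℝ), IsLimitOperator M ι ε F Fil A →
      A.IsClosable ∧
      ∃ T : ConservativeMarkovSemigroup X,
        IsGenerator T A.closure ∧
        ∀ (f : C(X, ℝ)) (S : ℝ≥0),
          TendstoUniformlyOn
            (fun (n : ℕ) (t : ℝ≥0) =>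
              ‖(M.upDown n ^ ⌊(ε n)⁻¹ * (t : ℝ)⌋₊) (restr ι n f) - restr ι n (T.op t f)‖)
            (fun _ => 0) atTop (Set.Icc 0 S) := by
  have hmono := hF.mono
  have hfd := hF.finiteDimensional
  obtain rfl := hF.iSup_eq
  have hdense := hF.dense
  have hmem : ∀ f ∈ (⨆ m, Fil m : Submodule ℝ C(X, ℝ)), ∃ m, f ∈ Fil m := fun f =>
    (Submodule.mem_iSup_of_directed Fil hmono.directed_le).1
  refine ⟨existsUnique_isLimitOperator hι hmono rfl hlim, fun A hA => ?_⟩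
  have hdom : ∀ m, Fil m ≤ A.domain := fun m => (le_iSup Fil m).trans hA.1.ge
  let a : ∀ m, Fil m →ₗ[ℝ] Fil m := fun m =>
    (A.toFun ∘ₗ Submodule.inclusion (hdom m)).codRestrict (Fil m) fun v =>
      (hA.2 m (Submodule.inclusion (hdom m) v) v.2).1
  have ha : ∀ m (v : Fil m), IsLimitIn M ι ε (Fil m) v (a m v) := fun m v =>
    hA.2 m (Submodule.inclusion (hdom m) v) v.2
  have hG : ∀ x, x ∈ A.graph ↔ ∃ m, ∃ v : Fil m, x = ((v : C(X, ℝ)), (a m v : C(X, ℝ))) := by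
    intro x
    rw [LinearPMap.mem_graph_iff]
    constructor
    · rintro ⟨y, hy₁, hy₂⟩
      obtain ⟨m, hm⟩ := hmem y (hA.1 ▸ y.2)
      exact ⟨m, ⟨y, hm⟩, Prod.ext hy₁.symm hy₂.symm⟩
    · rintro ⟨m, v, rfl⟩
      exact ⟨Submodule.inclusion (hdom m) v, rfl, rfl⟩
  obtain ⟨T, hT0, hTadd, hTcont, hTnorm, hTker, hgen, hconv⟩ :=
    exists_contractionSemigroup_of_approximation (Y := fun n => L n → ℝ)
      (P := fun n => M.upDown n) (r := fun n => restr ι n) hmono hdense a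
      (fun m m' h v => Subtype.ext
        (((ha m' (Submodule.inclusion (hmono h) v))).unique hι (ha m v)))
      (fun n => norm_upDown_apply_le hM n) (fun n => norm_restr_le n)
      (fun f c hc => norm_le_of_tendsto_of_norm_restr_le hι tendsto_const_nhds hc) hε hε0
      (fun m v => (ha m v).tendsto) hG
  have hT1 : ∀ t, T t 1 = 1 := by
    intro t
    obtain ⟨m, hm⟩ := hmem 1 hone
    exact hTker m ⟨1, hm⟩
      (Subtype.ext ((ha m ⟨1, hm⟩).unique hι (isLimitIn_one hM hm))) t
  have hclos : A.IsClosable := by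
    refine ⟨A.graph.topologicalClosure.toLinearPMap,
      (Submodule.toLinearPMap_graph_eq _ ?_).symm⟩
    -- A pair `(0, y)` in the closure of the graph has `y` as the limit of the difference quotients
    -- of the zero orbit, so `y = 0`.
    rintro ⟨x, y⟩ hxy hx
    obtain rfl : x = 0 := hx
    have h := (hgen 0 y).1 hxy
    simp only [map_zero, sub_zero, smul_zero] at h
    exact tendsto_nhds_unique h tendsto_const_nhds
  refine ⟨hclos, ⟨T, hT0, hTadd, hTcont, hTnorm,
    fun t f hf => ContinuousMap.apply_nonneg_of_norm_le_one (T t) (hTnorm t) (hT1 t) hf, hT1⟩,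
    fun f g => ?_, fun f S => ?_⟩
  · rw [← hclos.graph_closure_eq_closure_graph]
    exact hgen f g
  · rw [Metric.tendstoUniformlyOn_iff]
    intro δ hδ
    filter_upwards [hconv f S δ hδ] with n hn t ht
    rw [dist_zero_left, norm_norm]
    exact hn t ht.2
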